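/- Throughout, a tensor category is a symmetric monoidal category, a tensor functor is a strong symmetric monoidal functor, a morphism of tensor functors is a monoidal natural transformation, and "small" means essentially small (equivalent to a category with a set of objects and sets of morphisms). Let $\mathcal{A}$ be a small tensor category, let $\mathcal{I}$ be a small category, and let $F,G : \mathcal{I} \rightrightarrows \mathcal{A}$ be two functors into the underlying category of $\mathcal{A}$. Then there are a small tensor category $\mathcal{B}$, a tensor functor $P : \mathcal{A} \to \mathcal{B}$ and a natural transformation $\delta : P \circ F \to P \circ G$ (of plain functors) with the following universal property: for every small tensor category $\mathcal{C}$, the functor $$\mathrm{Hom}_{\otimes}(\mathcal{B},\mathcal{C}) \longrightarrow \{(H,\gamma) : H \in \mathrm{Hom}_{\otimes}(\mathcal{A},\mathcal{C}),\ \gamma : H \circ F \to H \circ G\}, \qquad K \mapsto (K \circ P,\, K \circ \delta)$$ is an equivalence of categories. Here $\mathrm{Hom}_{\otimes}(\mathcal{B},\mathcal{C})$ is the category of tensor functors $\mathcal{B} \to \mathcal{C}$ and their morphisms; in the category on the right, a morphism $(H,\gamma) \to (H',\gamma')$ is a morphism of tensor functors $\vartheta : H \to H'$ with $(\vartheta \circ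 G)\cdot\gamma = \gamma'\cdot(\vartheta \circ F)$; and the functor sends a morphism $\pi : K \to L$ to $\pi \circ P$. -/

import Mathlib

open CategoryTheory MonoidalCategory

universe w v₁ v₂ v₃ v₄ u₁ u₂ u₃ u₄

namespace TensorCat

/-! ## Tensor functors and their morphisms -/

section TensorFunctors

/-- A tensor functor between tensor (i.e. symmetric monoidal) categories: a functor together with
the structure of a strong symmetric monoidal functor. -/
structure TensorFunctor (A : Type u₁) [Category.{v₁} A] [MonoidalCategory A] [SymmetricCategory A]
    (C : Type u₂) [Category.{v₂} C] [MonoidalCategory C] [SymmetricCategory C] where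
  /-- The underlying functor. -/
  toFunctor : A ⥤ C
  /-- The strong symmetric monoidal structure. -/
  [braided : toFunctor.Braided]

attribute [instance] TensorFunctor.braided

variable {A : Type u₁} [Category.{v₁} A] [MonoidalCategory A] [SymmetricCategory A]
  {B : Type u₂} [Category.{v₂} B] [MonoidalCategory B] [SymmetricCategory B]
  {C : Type u₃} [Category.{v₃} C] [MonoidalCategory C] [SymmetricCategory C]

namespace TensorFunctor

/-- A morphism of tensor functors: a natural transformation that is compatible with the unit
isomorphisms and with the tensor product isomorphisms. -/
@[ext]
structure Hom (H K : TensorFunctor A C) where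
  /-- The underlying natural transformation. -/
  toNatTrans : H.toFunctor ⟶ K.toFunctor
  /-- Compatibility with the monoidal structures. -/
  [isMonoidal : NatTrans.IsMonoidal toNatTrans]

attribute [instance] Hom.isMonoidal

/-- The category of tensor functors from `A` to `C`. -/
instance : Category (TensorFunctor A C) where
  Hom H K := Hom H K
  id H := { toNatTrans := 𝟙 H.toFunctor }
  comp θ η := { toNatTrans := θ.toNatTrans ≫ η.toNatTrans }

@[simp]
theorem id_toNatTrans (H : TensorFunctor A C) : (𝟙 H : H ⟶ H).toNatTrans = 𝟙 H.toFunctor := rfl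

@[simp]
theorem comp_toNatTrans {H K L : TensorFunctor A C} (θ : H ⟶ K) (η : K ⟶ L) :
    (θ ≫ η).toNatTrans = θ.toNatTrans ≫ η.toNatTrans := rfl

@[ext]
theorem hom_ext {H K : TensorFunctor A C} {θ η : H ⟶ K} (h : θ.toNatTrans = η.toNatTrans) :
    θ = η :=
  Hom.ext h

/-- The composition of two tensor functors. -/
@[simps]
def comp (P : TensorFunctor A B) (K : TensorFunctor B C) : TensorFunctor A C where
  toFunctor := P.toFunctor ⋙ K.toFunctor

/-- Whiskering a morphism of tensor functors with a tensor functor. -/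
@[simps]
def whiskerLeft (P : TensorFunctor A B) {K L : TensorFunctor B C} (θ : K ⟶ L) :
    P.comp K ⟶ P.comp L where
  toNatTrans := Functor.whiskerLeft P.toFunctor θ.toNatTrans
  isMonoidal := inferInstanceAs
    (NatTrans.IsMonoidal (Functor.whiskerLeft P.toFunctor θ.toNatTrans))

end TensorFunctor

end TensorFunctors

/-! ## Tensor functors equipped with a coinserting morphism -/

section CoinsertingTensor

variable {I : Type u₁} [Category.{v₁} I]
  {A : Type u₂} [Category.{v₂} A] [MonoidalCategory A] [SymmetricCategory A]

/-- Tensor functors `H` from `A` to `C` equipped with a natural transformation `H ∘ F ⟶ H ∘ G`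
of plain functors. -/
structure CoinsertingTensorFunctor (F G : I ⥤ A)
    (C : Type u₃) [Category.{v₃} C] [MonoidalCategory C] [SymmetricCategory C] where
  /-- The tensor functor. -/
  tensorFunctor : TensorFunctor A C
  /-- The natural transformation. -/
  nat : F ⋙ tensorFunctor.toFunctor ⟶ G ⋙ tensorFunctor.toFunctor

namespace CoinsertingTensorFunctor

variable {F G : I ⥤ A}
  {C : Type u₃} [Category.{v₃} C] [MonoidalCategory C] [SymmetricCategory C]

/-- A morphism `(H, γ) ⟶ (H', γ')` is a morphism of tensor functors `θ : H ⟶ H'` such that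
`(θ ∘ G) · γ = γ' · (θ ∘ F)`. -/
@[ext]
structure Hom (X Y : CoinsertingTensorFunctor F G C) where
  /-- The underlying morphism of tensor functors. -/
  hom : X.tensorFunctor ⟶ Y.tensorFunctor
  /-- Compatibility with the coinserting morphisms. -/
  comm : X.nat ≫ Functor.whiskerLeft G hom.toNatTrans =
    Functor.whiskerLeft F hom.toNatTrans ≫ Y.nat

instance : Category (CoinsertingTensorFunctor F G C) where
  Hom X Y := Hom X Y
  id X := { hom := 𝟙 X.tensorFunctor, comm := by simp }
  comp θ η :=
    { hom := θ.hom ≫ η.hom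
      comm := by
        rw [TensorFunctor.comp_toNatTrans, Functor.whiskerLeft_comp,
          ← Category.assoc, θ.comm, Category.assoc, η.comm, Functor.whiskerLeft_comp,
          Category.assoc] }

@[simp]
theorem id_hom (X : CoinsertingTensorFunctor F G C) : (𝟙 X : X ⟶ X).hom = 𝟙 X.tensorFunctor := rfl

@[simp]
theorem comp_hom {X Y Z : CoinsertingTensorFunctor F G C} (θ : X ⟶ Y) (η : Y ⟶ Z) :
    (θ ≫ η).hom = θ.hom ≫ η.hom := rfl

@[ext]
theorem hom_ext {X Y : CoinsertingTensorFunctor F G C} {θ η : X ⟶ Y} (h : θ.hom = η.hom) :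
    θ = η :=
  Hom.ext h

end CoinsertingTensorFunctor

/-- For a tensor functor `P` from `A` to `B` with `δ : P ∘ F ⟶ P ∘ G`, the comparison functor
`K ↦ (K ∘ P, K ∘ δ)` from tensor functors `B → C` to tensor functors `A → C` equipped with a
coinserting morphism. -/
@[simps]
def tensorCoinserterComparison {F G : I ⥤ A}
    {B : Type u₃} [Category.{v₃} B] [MonoidalCategory B] [SymmetricCategory B]
    (P : TensorFunctor A B) (δ : F ⋙ P.toFunctor ⟶ G ⋙ P.toFunctor)
    (C : Type u₄) [Category.{v₄} C] [MonoidalCategory C] [SymmetricCategory C] :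
    TensorFunctor B C ⥤ CoinsertingTensorFunctor F G C where
  obj K :=
    { tensorFunctor := P.comp K
      nat := Functor.whiskerRight δ K.toFunctor }
  map θ :=
    { hom := P.whiskerLeft θ
      comm := by ext i; exact (θ.toNatTrans.naturality (δ.app i)) }

end CoinsertingTensor

end TensorCat

/-!
The tensor category `B` is obtained from `A` by freely adjoining a natural transformation
`F ⟶ G`, by generators and relations. It has the objects of `A`; its morphisms are classes of
formal expressions (`TensorCat.CoinserterTerm`) built from the morphisms of `A` and one new
morphism `F i ⟶ G i` for each `i` by composition and tensor product, modulo the axioms of a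
symmetric monoidal category, the relations holding in `A`, and naturality in `i`
(`TensorCat.CoinserterTerm.Rel`). The coherence isomorphisms are those of `A`, so the coherence
axioms hold because they hold in `A`, and the functor `A ⥤ B` is strictly monoidal.

A tensor functor `H` on `A` with a natural transformation `H ∘ F ⟶ H ∘ G` evaluates formal
expressions, using the tensorator of `H` to interpret tensor products; this gives essential
surjectivity of the comparison functor. Since `A` and `B` have the same objects, a monoidal
transformation on `B` is determined by its restriction to `A`, and a restriction extends as soon
as it is natural with respect to the generators, which is the compatibility required of morphisms
of pairs. This is `TensorCat.TensorCoinserter.isEquivalence_comparison`.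

Formal expressions live in the universe of the objects and morphisms of `A` and the objects of
`I`. To obtain `B` in the universe `w`, the construction is applied to small models of `A` and `I`,
and the result is transferred along restriction functors which are equivalences:
`TensorCat.CoinsertingTensorFunctor.reindex` in the variable `I`, and
`TensorCat.CoinsertingTensorFunctor.restrict` in the variable `A`.
-/

namespace TensorCat

/-! ### The tensor coinserter by generators and relations -/

section Construction

variable {I : Type u₁} [Category.{v₁} I]
  {A : Type u₂} [Category.{v₂} A] [MonoidalCategory A] [SymmetricCategory A]

/-- Formal expressions for morphisms of the tensor coinserter of `F` and `G`: they are built from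
the morphisms of `A` and one new morphism `F i ⟶ G i` for every object `i` by composition and
tensor product. Identities are not needed as a separate constructor, they come from `A`. -/
inductive CoinserterTerm (F G : I ⥤ A) : A → A → Type max u₁ u₂ v₂
  | of {X Y : A} (f : X ⟶ Y) : CoinserterTerm F G X Y
  | gen (i : I) : CoinserterTerm F G (F.obj i) (G.obj i)
  | comp {X Y Z : A} (s : CoinserterTerm F G X Y) (t : CoinserterTerm F G Y Z) :
      CoinserterTerm F G X Z
  | tensor {X Y X' Y' : A} (s : CoinserterTerm F G X Y) (t : CoinserterTerm F G X' Y') :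
      CoinserterTerm F G (X ⊗ X') (Y ⊗ Y')

namespace CoinserterTerm

variable {F G : I ⥤ A}

/-- The congruence on formal expressions generated by the axioms of a symmetric monoidal category
(with the structure isomorphisms of `A`), the strict compatibility of `of` with composition and
tensor product, and the naturality of the new morphisms. -/
inductive Rel : ∀ {X Y : A}, CoinserterTerm F G X Y → CoinserterTerm F G X Y → Prop
  | refl {X Y} (s : CoinserterTerm F G X Y) : Rel s s
  | symm {X Y} {s t : CoinserterTerm F G X Y} : Rel s t → Rel t s
  | trans {X Y} {s t u : CoinserterTerm F G X Y} : Rel s t → Rel t u → Rel s u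
  | comp_congr {X Y Z} {s s' : CoinserterTerm F G X Y} {t t' : CoinserterTerm F G Y Z} :
      Rel s s' → Rel t t' → Rel (s.comp t) (s'.comp t')
  | tensor_congr {X Y X' Y'} {s s' : CoinserterTerm F G X Y} {t t' : CoinserterTerm F G X' Y'} :
      Rel s s' → Rel t t' → Rel (s.tensor t) (s'.tensor t')
  | id_comp {X Y} (s : CoinserterTerm F G X Y) : Rel ((of (𝟙 X)).comp s) s
  | comp_id {X Y} (s : CoinserterTerm F G X Y) : Rel (s.comp (of (𝟙 Y))) s
  | assoc {X Y Z W} (s : CoinserterTerm F G X Y) (t : CoinserterTerm F G Y Z)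
      (u : CoinserterTerm F G Z W) : Rel ((s.comp t).comp u) (s.comp (t.comp u))
  | of_comp {X Y Z} (f : X ⟶ Y) (g : Y ⟶ Z) : Rel (of (f ≫ g)) ((of f).comp (of g))
  | of_tensor {X Y X' Y'} (f : X ⟶ Y) (g : X' ⟶ Y') : Rel (of (f ⊗ₘ g)) ((of f).tensor (of g))
  | tensor_comp {X Y Z X' Y' Z'} (s : CoinserterTerm F G X Y) (s' : CoinserterTerm F G X' Y')
      (t : CoinserterTerm F G Y Z) (t' : CoinserterTerm F G Y' Z') :
      Rel ((s.tensor s').comp (t.tensor t')) ((s.comp t).tensor (s'.comp t'))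
  | associator_naturality {X Y X' Y' X'' Y''} (s : CoinserterTerm F G X Y)
      (t : CoinserterTerm F G X' Y') (u : CoinserterTerm F G X'' Y'') :
      Rel (((s.tensor t).tensor u).comp (of (α_ Y Y' Y'').hom))
        ((of (α_ X X' X'').hom).comp (s.tensor (t.tensor u)))
  | leftUnitor_naturality {X Y} (s : CoinserterTerm F G X Y) :
      Rel (((of (𝟙 (𝟙_ A))).tensor s).comp (of (λ_ Y).hom)) ((of (λ_ X).hom).comp s)
  | rightUnitor_naturality {X Y} (s : CoinserterTerm F G X Y) :
      Rel ((s.tensor (of (𝟙 (𝟙_ A)))).comp (of (ρ_ Y).hom)) ((of (ρ_ X).hom).comp s)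
  | braiding_naturality {X Y X' Y'} (s : CoinserterTerm F G X Y) (t : CoinserterTerm F G X' Y') :
      Rel ((s.tensor t).comp (of (β_ Y Y').hom)) ((of (β_ X X').hom).comp (t.tensor s))
  | gen_naturality {i j : I} (φ : i ⟶ j) :
      Rel ((of (F.map φ)).comp (gen j)) ((gen i).comp (of (G.map φ)))

instance setoid (F G : I ⥤ A) (X Y : A) : Setoid (CoinserterTerm F G X Y) where
  r := Rel
  iseqv := ⟨Rel.refl, Rel.symm, Rel.trans⟩

end CoinserterTerm

/-- The tensor coinserter of `F` and `G`: the symmetric monoidal category obtained from `A` by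
freely adjoining a natural transformation `F ⟶ G`. Its objects are those of `A`, wrapped in a
structure so as to carry new morphisms. -/
structure TensorCoinserter (F G : I ⥤ A) where
  /-- The underlying object of `A`. -/
  as : A

namespace TensorCoinserter

open CoinserterTerm

variable {F G : I ⥤ A}

instance : Category (TensorCoinserter F G) where
  Hom X Y := Quotient (CoinserterTerm.setoid F G X.as Y.as)
  id X := Quotient.mk _ (of (𝟙 X.as))
  comp f g := Quotient.map₂ CoinserterTerm.comp (fun _ _ h _ _ h' ↦ Rel.comp_congr h h') f g
  id_comp := by rintro X Y ⟨f⟩; exact Quotient.sound (Rel.id_comp f)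
  comp_id := by rintro X Y ⟨f⟩; exact Quotient.sound (Rel.comp_id f)
  assoc := by rintro X Y Z W ⟨f⟩ ⟨g⟩ ⟨h⟩; exact Quotient.sound (Rel.assoc f g h)

/-- The morphism of the tensor coinserter represented by a formal expression. -/
def homMk {X Y : A} (t : CoinserterTerm F G X Y) :
    (⟨X⟩ : TensorCoinserter F G) ⟶ ⟨Y⟩ :=
  Quotient.mk _ t

variable (F G) in
/-- The canonical functor from `A` to the tensor coinserter, the identity on objects. -/
def incl : A ⥤ TensorCoinserter F G where
  obj X := ⟨X⟩
  map f := homMk (of f)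
  map_id _ := rfl
  map_comp f g := Quotient.sound (Rel.of_comp f g)

/-- The tensor product of morphisms of the tensor coinserter. -/
def tensorMap {X₁ Y₁ X₂ Y₂ : TensorCoinserter F G} (f : X₁ ⟶ Y₁) (g : X₂ ⟶ Y₂) :
    (⟨X₁.as ⊗ X₂.as⟩ : TensorCoinserter F G) ⟶ ⟨Y₁.as ⊗ Y₂.as⟩ :=
  Quotient.map₂ CoinserterTerm.tensor (fun _ _ h _ _ h' ↦ Rel.tensor_congr h h') f g

instance : MonoidalCategoryStruct (TensorCoinserter F G) where
  tensorObj X Y := ⟨X.as ⊗ Y.as⟩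
  whiskerLeft X _ _ f := tensorMap (𝟙 X) f
  whiskerRight f Y := tensorMap f (𝟙 Y)
  tensorHom f g := tensorMap f g
  tensorUnit := ⟨𝟙_ A⟩
  associator X Y Z := (incl F G).mapIso (α_ X.as Y.as Z.as)
  leftUnitor X := (incl F G).mapIso (λ_ X.as)
  rightUnitor X := (incl F G).mapIso (ρ_ X.as)

/-- Strict compatibility of `incl` with tensor products. It carries the coherence axioms from `A`
to the tensor coinserter. -/
theorem incl_map_tensorHom {X₁ Y₁ X₂ Y₂ : A} (f : X₁ ⟶ Y₁) (g : X₂ ⟶ Y₂) :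
    (incl F G).map (f ⊗ₘ g) =
      MonoidalCategoryStruct.tensorHom ((incl F G).map f) ((incl F G).map g) :=
  Quotient.sound (Rel.of_tensor f g)

instance : MonoidalCategory (TensorCoinserter F G) :=
  .ofTensorHom
    (id_tensorHom_id := fun X Y ↦
      (incl_map_tensorHom (𝟙 X.as) (𝟙 Y.as)).symm.trans
        (congrArg (incl F G).map (id_tensorHom_id X.as Y.as)))
    (id_tensorHom := fun _ _ _ _ ↦ rfl)
    (tensorHom_id := fun _ _ ↦ rfl)
    (tensorHom_comp_tensorHom := by
      rintro _ _ _ _ _ _ ⟨f₁⟩ ⟨f₂⟩ ⟨g₁⟩ ⟨g₂⟩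
      exact Quotient.sound (Rel.tensor_comp f₁ f₂ g₁ g₂))
    (associator_naturality := by
      rintro _ _ _ _ _ _ ⟨f₁⟩ ⟨f₂⟩ ⟨f₃⟩
      exact Quotient.sound (Rel.associator_naturality f₁ f₂ f₃))
    (leftUnitor_naturality := by
      rintro _ _ ⟨f⟩
      exact Quotient.sound (Rel.leftUnitor_naturality f))
    (rightUnitor_naturality := by
      rintro _ _ ⟨f⟩
      exact Quotient.sound (Rel.rightUnitor_naturality f))
    (pentagon := fun W X Y Z ↦ by
      have h := congrArg (incl F G).map (pentagon W.as X.as Y.as Z.as)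
      rw [← tensorHom_id, ← id_tensorHom] at h
      simp only [Functor.map_comp, incl_map_tensorHom] at h
      exact h)
    (triangle := fun X Y ↦ by
      have h := congrArg (incl F G).map (triangle X.as Y.as)
      rw [← tensorHom_id, ← id_tensorHom] at h
      simp only [Functor.map_comp, incl_map_tensorHom] at h
      exact h)

theorem incl_map_whiskerLeft (X : A) {Y Z : A} (f : Y ⟶ Z) :
    (incl F G).map (X ◁ f) = (incl F G).obj X ◁ (incl F G).map f := by
  rw [← id_tensorHom, incl_map_tensorHom]
  rfl

theorem incl_map_whiskerRight {Y Z : A} (f : Y ⟶ Z) (X : A) :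
    (incl F G).map (f ▷ X) = (incl F G).map f ▷ (incl F G).obj X := by
  rw [← tensorHom_id, incl_map_tensorHom]
  rfl

theorem braiding_naturality {X₁ Y₁ X₂ Y₂ : TensorCoinserter F G} (f : X₁ ⟶ Y₁) (g : X₂ ⟶ Y₂) :
    (f ⊗ₘ g) ≫ (incl F G).map (β_ Y₁.as Y₂.as).hom =
      (incl F G).map (β_ X₁.as X₂.as).hom ≫ (g ⊗ₘ f) := by
  obtain ⟨f⟩ := f
  obtain ⟨g⟩ := g
  exact Quotient.sound (Rel.braiding_naturality f g)

instance : SymmetricCategory (TensorCoinserter F G) where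
  braiding X Y := (incl F G).mapIso (β_ X.as Y.as)
  braiding_naturality_right X _ _ f := braiding_naturality (𝟙 X) f
  braiding_naturality_left f Z := braiding_naturality f (𝟙 Z)
  hexagon_forward X Y Z := by
    have h := congrArg (incl F G).map (BraidedCategory.hexagon_forward X.as Y.as Z.as)
    simp only [Functor.map_comp, incl_map_whiskerLeft, incl_map_whiskerRight] at h
    exact h
  hexagon_reverse X Y Z := by
    have h := congrArg (incl F G).map (BraidedCategory.hexagon_reverse X.as Y.as Z.as)
    simp only [Functor.map_comp, incl_map_whiskerLeft, incl_map_whiskerRight] at h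
    exact h
  symmetry X Y := by
    have h := congrArg (incl F G).map (SymmetricCategory.symmetry X.as Y.as)
    rw [Functor.map_comp] at h
    exact h

variable (F G) in
/-- The strict monoidal structure on `incl`: the unit and tensor product of the tensor coinserter
are those of `A` by definition, so the structure isomorphisms are identities. -/
def inclCoreMonoidal : (incl F G).CoreMonoidal where
  εIso := Iso.refl _
  μIso _ _ := Iso.refl _
  μIso_hom_natural_left f X := by
    rw [incl_map_whiskerRight]
    exact (Category.comp_id _).trans (Category.id_comp _).symm
  μIso_hom_natural_right X f := by
    rw [incl_map_whiskerLeft]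
    exact (Category.comp_id _).trans (Category.id_comp _).symm
  associativity X Y Z := by
    change 𝟙 (_ ⊗ _) ▷ _ ≫ 𝟙 (_ ⊗ _) ≫ (α_ _ _ _).hom =
      (α_ _ _ _).hom ≫ _ ◁ 𝟙 (_ ⊗ _) ≫ 𝟙 (_ ⊗ _ ⊗ _)
    simp
  left_unitality X := by
    change (λ_ _).hom = 𝟙 (𝟙_ _) ▷ _ ≫ 𝟙 (_ ⊗ _) ≫ (λ_ _).hom
    simp
  right_unitality X := by
    change (ρ_ _).hom = _ ◁ 𝟙 (𝟙_ _) ≫ 𝟙 (_ ⊗ _) ≫ (ρ_ _).hom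
    simp

instance : (incl F G).Braided where
  toMonoidal := (inclCoreMonoidal F G).toMonoidal
  braided _ _ := (Category.id_comp _).trans (Category.comp_id _).symm

variable (F G) in
/-- The universal tensor functor from `A` to the tensor coinserter. -/
def inclTensor : TensorFunctor A (TensorCoinserter F G) where
  toFunctor := incl F G

variable (F G) in
/-- The universal natural transformation, given by the new morphisms. -/
def nat : F ⋙ (inclTensor F G).toFunctor ⟶ G ⋙ (inclTensor F G).toFunctor where
  app i := homMk (gen i)
  naturality _ _ φ := Quotient.sound (Rel.gen_naturality φ)

end TensorCoinserter

end Construction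

/-! ### The universal property -/

open Functor.LaxMonoidal Functor.OplaxMonoidal

/-- Naturality of the image of the associator under a monoidal functor `H`, for arbitrary morphisms
between objects in the image of `H`, tensored by means of the tensorator of `H`. -/
theorem map_associator_naturality {A : Type u₁} [Category.{v₁} A] [MonoidalCategory A]
    {C : Type u₂} [Category.{v₂} C] [MonoidalCategory C] (H : A ⥤ C) [H.Monoidal]
    {X Y X' Y' X'' Y'' : A}
    (s : H.obj X ⟶ H.obj Y) (t : H.obj X' ⟶ H.obj Y') (u : H.obj X'' ⟶ H.obj Y'') :
    (δ H _ _ ≫ ((δ H _ _ ≫ (s ⊗ₘ t) ≫ μ H _ _) ⊗ₘ u) ≫ μ H _ _) ≫ H.map (α_ Y Y' Y'').hom =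
      H.map (α_ X X' X'').hom ≫ δ H _ _ ≫ (s ⊗ₘ (δ H _ _ ≫ (t ⊗ₘ u) ≫ μ H _ _)) ≫ μ H _ _ := by
  have h₁ : (δ H X X' ≫ (s ⊗ₘ t) ≫ μ H Y Y') ⊗ₘ u =
      δ H X X' ▷ _ ≫ ((s ⊗ₘ t) ⊗ₘ u) ≫ μ H Y Y' ▷ _ := by
    simp only [← tensorHom_id, tensorHom_comp_tensorHom, Category.id_comp, Category.comp_id]
  have h₂ : s ⊗ₘ (δ H X' X'' ≫ (t ⊗ₘ u) ≫ μ H Y' Y'') =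
      _ ◁ δ H X' X'' ≫ (s ⊗ₘ (t ⊗ₘ u)) ≫ _ ◁ μ H Y' Y'' := by
    simp only [← id_tensorHom, tensorHom_comp_tensorHom, Category.id_comp, Category.comp_id]
  rw [h₁, h₂]
  simp only [Category.assoc]
  rw [Functor.LaxMonoidal.associativity, associator_naturality_assoc,
    Functor.OplaxMonoidal.associativity_assoc]

section UniversalProperty

variable {I : Type u₁} [Category.{v₁} I]
  {A : Type u₂} [Category.{v₂} A] [MonoidalCategory A] [SymmetricCategory A]
  {F G : I ⥤ A}
  {C : Type u₃} [Category.{v₃} C] [MonoidalCategory C] [SymmetricCategory C]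

/-- An isomorphism of tensor functors that is compatible with the natural transformations
`X.nat` and `Y.nat` gives an isomorphism of tensor functors equipped with them. -/
def CoinsertingTensorFunctor.isoMk {X Y : CoinsertingTensorFunctor F G C}
    (e : X.tensorFunctor.toFunctor ≅ Y.tensorFunctor.toFunctor) (_ : NatTrans.IsMonoidal e.hom)
    (comm : X.nat ≫ Functor.whiskerLeft G e.hom = Functor.whiskerLeft F e.hom ≫ Y.nat) :
    X ≅ Y where
  hom := { hom := { toNatTrans := e.hom }, comm := comm }
  inv :=
    { hom := { toNatTrans := e.inv }
      comm := by
        ext i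
        have h := congr_app comm i
        simp only [NatTrans.comp_app, Functor.whiskerLeft_app] at h ⊢
        rw [← cancel_epi (e.hom.app (F.obj i)), ← reassoc_of% h]
        simp }
  hom_inv_id := by ext1; ext1; exact e.hom_inv_id
  inv_hom_id := by ext1; ext1; exact e.inv_hom_id

namespace CoinserterTerm

/-- The value of a formal expression in `C`, given a tensor functor `A → C` equipped with a
natural transformation interpreting the new morphisms. -/
def eval (H : CoinsertingTensorFunctor F G C) : ∀ {X Y : A}, CoinserterTerm F G X Y →
    (H.tensorFunctor.toFunctor.obj X ⟶ H.tensorFunctor.toFunctor.obj Y)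
  | _, _, of f => H.tensorFunctor.toFunctor.map f
  | _, _, gen i => H.nat.app i
  | _, _, comp s t => eval H s ≫ eval H t
  | _, _, tensor s t => δ H.tensorFunctor.toFunctor _ _ ≫ (eval H s ⊗ₘ eval H t) ≫
      μ H.tensorFunctor.toFunctor _ _

/-- Evaluation respects the relations. -/
theorem Rel.eval_eq (H : CoinsertingTensorFunctor F G C) {X Y : A} {s t : CoinserterTerm F G X Y}
    (h : Rel s t) : eval H s = eval H t := by
  induction h with
  | refl => rfl
  | symm _ ih => exact ih.symm
  | trans _ _ ih ih' => exact ih.trans ih'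
  | comp_congr _ _ ih ih' => simp only [eval, ih, ih']
  | tensor_congr _ _ ih ih' => simp only [eval, ih, ih']
  | id_comp => simp [eval]
  | comp_id => simp [eval]
  | assoc => simp [eval]
  | of_comp => simp [eval]
  | of_tensor => simp [eval]
  | tensor_comp => simp [eval]
  | associator_naturality s t u =>
    exact map_associator_naturality H.tensorFunctor.toFunctor (eval H s) (eval H t) (eval H u)
  | leftUnitor_naturality s =>
    simp only [eval, CategoryTheory.Functor.map_id, id_tensorHom, Category.assoc,
      Functor.Monoidal.map_leftUnitor, Functor.Monoidal.μ_δ_assoc, whisker_exchange_assoc,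
      MonoidalCategory.leftUnitor_naturality]
  | rightUnitor_naturality s =>
    simp only [eval, CategoryTheory.Functor.map_id, tensorHom_id, Category.assoc,
      Functor.Monoidal.map_rightUnitor, Functor.Monoidal.μ_δ_assoc, ← whisker_exchange_assoc,
      MonoidalCategory.rightUnitor_naturality]
  | braiding_naturality s t => simp [eval]
  | gen_naturality φ => exact H.nat.naturality φ

end CoinserterTerm

namespace TensorCoinserter

open CoinserterTerm

/-- The functor from the tensor coinserter induced by a tensor functor `A → C` equipped with a
natural transformation. -/
def desc (H : CoinsertingTensorFunctor F G C) : TensorCoinserter F G ⥤ C where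
  obj X := H.tensorFunctor.toFunctor.obj X.as
  map f := Quotient.lift (eval H) (fun _ _ h ↦ Rel.eval_eq H h) f
  map_id X := H.tensorFunctor.toFunctor.map_id X.as
  map_comp := by rintro _ _ _ ⟨f⟩ ⟨g⟩; rfl

/-- The functor `desc H` inherits the monoidal structure of the tensor functor it extends. -/
def descCoreMonoidal (H : CoinsertingTensorFunctor F G C) : (desc H).CoreMonoidal where
  εIso := Functor.Monoidal.εIso H.tensorFunctor.toFunctor
  μIso X Y := Functor.Monoidal.μIso H.tensorFunctor.toFunctor X.as Y.as
  μIso_hom_natural_left f X := by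
    obtain ⟨t⟩ := f
    change eval H t ▷ _ ≫ μ H.tensorFunctor.toFunctor _ _ = μ H.tensorFunctor.toFunctor _ _ ≫
      δ H.tensorFunctor.toFunctor _ _ ≫ (eval H t ⊗ₘ H.tensorFunctor.toFunctor.map (𝟙 X.as)) ≫
        μ H.tensorFunctor.toFunctor _ _
    rw [CategoryTheory.Functor.map_id, tensorHom_id, Functor.Monoidal.μ_δ_assoc]
  μIso_hom_natural_right X f := by
    obtain ⟨t⟩ := f
    change _ ◁ eval H t ≫ μ H.tensorFunctor.toFunctor _ _ = μ H.tensorFunctor.toFunctor _ _ ≫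
      δ H.tensorFunctor.toFunctor _ _ ≫ (H.tensorFunctor.toFunctor.map (𝟙 X.as) ⊗ₘ eval H t) ≫
        μ H.tensorFunctor.toFunctor _ _
    rw [CategoryTheory.Functor.map_id, id_tensorHom, Functor.Monoidal.μ_δ_assoc]
  associativity X Y Z := associativity H.tensorFunctor.toFunctor X.as Y.as Z.as
  left_unitality X := left_unitality H.tensorFunctor.toFunctor X.as
  right_unitality X := right_unitality H.tensorFunctor.toFunctor X.as

instance (H : CoinsertingTensorFunctor F G C) : (desc H).Braided where
  toMonoidal := (descCoreMonoidal H).toMonoidal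
  braided X Y := Functor.LaxBraided.braided (F := H.tensorFunctor.toFunctor) X.as Y.as

theorem desc_ε (H : CoinsertingTensorFunctor F G C) :
    ε (desc H) = ε H.tensorFunctor.toFunctor := rfl

theorem desc_μ (H : CoinsertingTensorFunctor F G C) (X Y : TensorCoinserter F G) :
    μ (desc H) X Y = μ H.tensorFunctor.toFunctor X.as Y.as := rfl

/-- The tensor functor from the tensor coinserter induced by a tensor functor `A → C` equipped
with a natural transformation. -/
def descTensor (H : CoinsertingTensorFunctor F G C) : TensorFunctor (TensorCoinserter F G) C where
  toFunctor := desc H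

/-- The restriction of the functor `desc H` to `A` is the functor underlying `H`. The two agree
definitionally on objects and morphisms, but their monoidal structures agree only up to composition
with identities. -/
def inclCompDescIso (H : CoinsertingTensorFunctor F G C) :
    incl F G ⋙ desc H ≅ H.tensorFunctor.toFunctor :=
  NatIso.ofComponents (fun _ ↦ Iso.refl _)
    fun _ ↦ (Category.comp_id _).trans (Category.id_comp _).symm

instance (H : CoinsertingTensorFunctor F G C) :
    NatTrans.IsMonoidal (inclCompDescIso H).hom where
  unit := by
    change (ε (desc H) ≫ (desc H).map (𝟙 _)) ≫ 𝟙 _ = _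
    rw [CategoryTheory.Functor.map_id, Category.comp_id, Category.comp_id, desc_ε]
  tensor X Y := by
    change (μ (desc H) ⟨X⟩ ⟨Y⟩ ≫ (desc H).map (𝟙 _)) ≫ 𝟙 _ =
      (𝟙 (H.tensorFunctor.toFunctor.obj X) ⊗ₘ 𝟙 (H.tensorFunctor.toFunctor.obj Y)) ≫ _
    rw [CategoryTheory.Functor.map_id, Category.comp_id, Category.comp_id, desc_μ, id_tensorHom_id]
    exact (Category.id_comp _).symm

/-- The restriction of `descTensor H` to `A`, with its natural transformation, is isomorphic to
`H`. -/
def comparisonDescIso (H : CoinsertingTensorFunctor F G C) :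
    (tensorCoinserterComparison (inclTensor F G) (nat F G) C).obj (descTensor H) ≅ H :=
  CoinsertingTensorFunctor.isoMk (inclCompDescIso H)
    (inferInstanceAs (NatTrans.IsMonoidal (inclCompDescIso H).hom)) (by
      ext i
      exact (Category.comp_id _).trans (Category.id_comp _).symm)

section Extension

variable {K L : TensorFunctor (TensorCoinserter F G) C}
  (θ : (tensorCoinserterComparison (inclTensor F G) (nat F G) C).obj K ⟶
    (tensorCoinserterComparison (inclTensor F G) (nat F G) C).obj L)

/-- The components of a morphism between restrictions of tensor functors, seen on the objects of
the tensor coinserter. -/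
def extApp (X : TensorCoinserter F G) : K.toFunctor.obj X ⟶ L.toFunctor.obj X :=
  θ.hom.toNatTrans.app X.as

theorem extApp_unit : ε K.toFunctor ≫ extApp θ (𝟙_ _) = ε L.toFunctor := by
  have h : (ε K.toFunctor ≫ K.toFunctor.map (𝟙 _)) ≫ extApp θ (𝟙_ _) =
      ε L.toFunctor ≫ L.toFunctor.map (𝟙 _) := θ.hom.isMonoidal.unit
  rwa [CategoryTheory.Functor.map_id, CategoryTheory.Functor.map_id, Category.comp_id,
    Category.comp_id] at h

theorem extApp_tensor (X Y : TensorCoinserter F G) :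
    μ K.toFunctor X Y ≫ extApp θ (X ⊗ Y) =
      (extApp θ X ⊗ₘ extApp θ Y) ≫ μ L.toFunctor X Y := by
  have h : (μ K.toFunctor X Y ≫ K.toFunctor.map (𝟙 _)) ≫ extApp θ (X ⊗ Y) =
      (extApp θ X ⊗ₘ extApp θ Y) ≫ μ L.toFunctor X Y ≫ L.toFunctor.map (𝟙 _) :=
    θ.hom.isMonoidal.tensor X.as Y.as
  rwa [CategoryTheory.Functor.map_id, CategoryTheory.Functor.map_id, Category.comp_id,
    Category.comp_id] at h

/-- Naturality with respect to all morphisms follows from naturality with respect to the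
generators: on morphisms of `A` it is naturality of `θ`, on the new morphisms it is the
compatibility of `θ` with the natural transformations. -/
theorem extApp_naturality_homMk {X Y : A} (t : CoinserterTerm F G X Y) :
    K.toFunctor.map (homMk t) ≫ extApp θ ⟨Y⟩ = extApp θ ⟨X⟩ ≫ L.toFunctor.map (homMk t) := by
  induction t with
  | of f => exact θ.hom.toNatTrans.naturality f
  | gen i => exact congr_app θ.comm i
  | @comp X Y Z s t ihs iht =>
    change K.toFunctor.map (homMk s ≫ homMk t) ≫ _ = _ ≫ L.toFunctor.map (homMk s ≫ homMk t)
    rw [Functor.map_comp, Functor.map_comp, Category.assoc, iht, reassoc_of% ihs]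
  | @tensor X Y X' Y' s t ihs iht =>
    change K.toFunctor.map (homMk s ⊗ₘ homMk t) ≫ extApp θ (⟨Y⟩ ⊗ ⟨Y'⟩) =
      extApp θ (⟨X⟩ ⊗ ⟨X'⟩) ≫ L.toFunctor.map (homMk s ⊗ₘ homMk t)
    rw [← cancel_epi (μ K.toFunctor _ _), ← μ_natural_assoc, extApp_tensor,
      reassoc_of% extApp_tensor, ← μ_natural, tensorHom_comp_tensorHom_assoc,
      tensorHom_comp_tensorHom_assoc, ihs, iht]

/-- A morphism between restrictions of tensor functors, compatible with the new morphisms, extends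
to the tensor coinserter. -/
def extend : K ⟶ L where
  toNatTrans :=
    { app := extApp θ
      naturality := by rintro X Y ⟨t⟩; exact extApp_naturality_homMk θ t }
  isMonoidal :=
    { unit := extApp_unit θ
      tensor := extApp_tensor θ }

end Extension

/-- The universal property of the tensor coinserter. -/
instance isEquivalence_comparison :
    (tensorCoinserterComparison (inclTensor F G) (nat F G) C).IsEquivalence where
  faithful := ⟨fun {K L θ η} h ↦ by
    ext X
    exact congr_app (congrArg (fun θ ↦ θ.hom.toNatTrans) h) X.as⟩
  full := ⟨fun θ ↦ ⟨extend θ, rfl⟩⟩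
  essSurj := ⟨fun H ↦ ⟨descTensor H, ⟨comparisonDescIso H⟩⟩⟩

end TensorCoinserter

end UniversalProperty

/-! ### Invariance under equivalences of the data -/

section Monoidal

variable {A : Type u₁} [Category.{v₁} A] [MonoidalCategory A]
  {A' : Type u₂} [Category.{v₂} A'] [MonoidalCategory A']
  {C : Type u₃} [Category.{v₃} C] [MonoidalCategory C]

/-- A natural transformation is monoidal if its restriction along an essentially surjective
monoidal functor is. -/
theorem isMonoidal_of_whiskerLeft (E : A ⥤ A') [E.Monoidal] [E.EssSurj] {H K : A' ⥤ C}
    [H.LaxMonoidal] [K.LaxMonoidal] (τ : H ⟶ K)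
    [hτ : NatTrans.IsMonoidal (Functor.whiskerLeft E τ)] : NatTrans.IsMonoidal τ where
  unit := by
    have h := hτ.unit
    simp only [comp_ε, Functor.whiskerLeft_app, Category.assoc, τ.naturality] at h
    -- `h` is the claim composed with the isomorphism `K.map (ε E)`.
    rwa [← Category.assoc, cancel_mono] at h
  tensor X Y := by
    have h := hτ.tensor (E.objPreimage X) (E.objPreimage Y)
    simp only [comp_μ, Functor.whiskerLeft_app, Category.assoc, τ.naturality] at h
    rw [← Category.assoc, ← Category.assoc, cancel_mono] at h
    -- `h` is the claim for objects in the image of `E`; it is moved to `X` and `Y` by naturality.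
    let eX := E.objObjPreimageIso X
    let eY := E.objObjPreimageIso Y
    rw [← cancel_epi (H.map eX.hom ⊗ₘ H.map eY.hom), μ_natural_assoc, τ.naturality,
      reassoc_of% h, tensorHom_comp_tensorHom_assoc, τ.naturality, τ.naturality,
      ← tensorHom_comp_tensorHom_assoc, μ_natural]

variable (e : A ≌ A')

/-- A functor `H` on `A` is isomorphic to the restriction along an equivalence `e` of its
restriction along the inverse of `e`. -/
def invCompIso (H : A ⥤ C) : e.functor ⋙ e.inverse ⋙ H ≅ H :=
  NatIso.ofComponents (fun X ↦ H.mapIso (e.unitIso.app X).symm) fun f ↦ by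
    simp [← Functor.map_comp]

variable [e.functor.Monoidal] [e.inverse.Monoidal] [e.IsMonoidal]

instance (H : A ⥤ C) [H.Monoidal] : NatTrans.IsMonoidal (invCompIso e H).hom where
  unit := by
    have h : ε (e.functor ⋙ e.inverse) ≫ e.unitInv.app _ = ε (𝟭 A) :=
      NatTrans.IsMonoidal.unit (τ := e.unitIso.inv)
    simp only [comp_ε, id_ε, Category.assoc] at h
    simp only [comp_ε, invCompIso, NatIso.ofComponents_hom_app, Functor.mapIso_hom, Iso.symm_hom,
      Iso.app_inv, Category.assoc, Functor.comp_map, ← H.map_comp]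
    exact (congrArg (fun f ↦ ε H ≫ H.map f) h).trans (by simp)
  tensor X Y := by
    have h : μ (e.functor ⋙ e.inverse) X Y ≫ e.unitInv.app _ =
        (e.unitInv.app X ⊗ₘ e.unitInv.app Y) ≫ μ (𝟭 A) X Y :=
      NatTrans.IsMonoidal.tensor (τ := e.unitIso.inv) X Y
    simp only [comp_μ, id_μ, Category.assoc] at h
    simp only [comp_μ, invCompIso, NatIso.ofComponents_hom_app, Functor.mapIso_hom, Iso.symm_hom,
      Iso.app_inv, Category.assoc, Functor.comp_map, ← H.map_comp, μ_natural]
    exact (congrArg (fun f ↦ μ H _ _ ≫ H.map f) h).trans (by simp)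

end Monoidal

section Invariance

variable {I : Type u₁} [Category.{v₁} I]
  {A : Type u₂} [Category.{v₂} A] [MonoidalCategory A] [SymmetricCategory A]
  {C : Type u₃} [Category.{v₃} C] [MonoidalCategory C] [SymmetricCategory C]

namespace CoinsertingTensorFunctor

/-- Restriction along a functor `e : J ⥤ I` of the source of `F` and `G`. -/
def reindex {J : Type u₄} [Category.{v₄} J] (e : J ⥤ I) (F G : I ⥤ A) :
    CoinsertingTensorFunctor F G C ⥤ CoinsertingTensorFunctor (e ⋙ F) (e ⋙ G) C where
  obj X :=
    { tensorFunctor := X.tensorFunctor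
      nat := Functor.whiskerLeft e X.nat }
  map θ :=
    { hom := θ.hom
      comm := by ext j; exact congr_app θ.comm (e.obj j) }

instance {J : Type u₄} [Category.{v₄} J] (e : J ⥤ I) [e.IsEquivalence] (F G : I ⥤ A) :
    (reindex (C := C) e F G).IsEquivalence where
  faithful := ⟨fun h ↦ by
    have h' := congrArg (fun θ ↦ θ.hom) h
    exact hom_ext h'⟩
  full := ⟨fun {X Y} θ ↦
    ⟨{ hom := θ.hom
       comm := ((Functor.whiskeringLeft J I C).obj e).map_injective θ.comm }, rfl⟩⟩
  essSurj := ⟨fun X ↦ by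
    let γ : F ⋙ X.tensorFunctor.toFunctor ⟶ G ⋙ X.tensorFunctor.toFunctor :=
      ((Functor.whiskeringLeft J I C).obj e).preimage X.nat
    have hγ : Functor.whiskerLeft e γ = X.nat :=
      ((Functor.whiskeringLeft J I C).obj e).map_preimage
        (X := F ⋙ X.tensorFunctor.toFunctor) (Y := G ⋙ X.tensorFunctor.toFunctor) X.nat
    exact ⟨{ tensorFunctor := X.tensorFunctor, nat := γ },
      ⟨eqToIso (congrArg (CoinsertingTensorFunctor.mk X.tensorFunctor) hγ)⟩⟩⟩

variable {A' : Type u₄} [Category.{v₄} A'] [MonoidalCategory A'] [SymmetricCategory A']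

/-- Restriction along a tensor functor `E : A → A'`. -/
def restrict (E : TensorFunctor A A') (F G : I ⥤ A) :
    CoinsertingTensorFunctor (F ⋙ E.toFunctor) (G ⋙ E.toFunctor) C ⥤
      CoinsertingTensorFunctor F G C where
  obj X :=
    { tensorFunctor := E.comp X.tensorFunctor
      nat := X.nat }
  map θ :=
    { hom := E.whiskerLeft θ.hom
      comm := θ.comm }

end CoinsertingTensorFunctor

variable {A' : Type u₄} [Category.{v₄} A'] [MonoidalCategory A'] [SymmetricCategory A']

namespace CoinsertingTensorFunctor

variable (e : A ≌ A') [e.functor.Braided] [e.inverse.Braided] [e.IsMonoidal]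

/-- Restriction along a tensor equivalence is an equivalence. A preimage of `(H, γ)` up to
isomorphism is `H` restricted along the inverse equivalence, with `γ` conjugated by `invCompIso`. -/
instance isEquivalence_restrict (F G : I ⥤ A) :
    (restrict (C := C) { toFunctor := e.functor } F G).IsEquivalence where
  faithful := ⟨fun {X Y θ η} h ↦ by
    ext1; ext1
    exact ((Functor.whiskeringLeft A A' C).obj e.functor).map_injective
      (congrArg (fun θ ↦ θ.hom.toNatTrans) h)⟩
  full := ⟨fun {X Y} θ ↦ by
    let τ : X.tensorFunctor.toFunctor ⟶ Y.tensorFunctor.toFunctor :=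
      ((Functor.whiskeringLeft A A' C).obj e.functor).preimage θ.hom.toNatTrans
    have h : Functor.whiskerLeft e.functor τ = θ.hom.toNatTrans :=
      ((Functor.whiskeringLeft A A' C).obj e.functor).map_preimage θ.hom.toNatTrans
    have : NatTrans.IsMonoidal (Functor.whiskerLeft e.functor τ) := by
      rw [h]; exact θ.hom.isMonoidal
    have := isMonoidal_of_whiskerLeft e.functor τ
    refine ⟨{ hom := { toNatTrans := τ }, comm := ?_ }, ?_⟩
    · have h' := θ.comm
      rw [← h] at h'
      exact h'
    · ext1; ext1; exact h⟩
  essSurj := ⟨fun X ↦ by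
    let H := X.tensorFunctor.toFunctor
    let i : e.functor ⋙ e.inverse ⋙ H ≅ H := invCompIso e H
    let T : TensorFunctor A' C := { toFunctor := e.inverse ⋙ H }
    let Y : CoinsertingTensorFunctor (F ⋙ e.functor) (G ⋙ e.functor) C :=
      { tensorFunctor := T
        nat := (Functor.isoWhiskerLeft F i).hom ≫ X.nat ≫ (Functor.isoWhiskerLeft G i).inv }
    let Z : CoinsertingTensorFunctor F G C := (restrict { toFunctor := e.functor } F G).obj Y
    refine ⟨Y, ⟨isoMk (X := Z) i (inferInstanceAs (NatTrans.IsMonoidal (invCompIso e H).hom)) ?_⟩⟩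
    ext k
    change (i.hom.app (F.obj k) ≫ X.nat.app k ≫ i.inv.app (G.obj k)) ≫ i.hom.app (G.obj k) =
      i.hom.app (F.obj k) ≫ X.nat.app k
    rw [Category.assoc, Category.assoc, Iso.inv_hom_id_app]
    exact congrArg (i.hom.app (F.obj k) ≫ ·) (Category.comp_id _)⟩

end CoinsertingTensorFunctor

section

variable {J : Type*} [Category* J] {B : Type*} [Category* B] [MonoidalCategory B]
  [SymmetricCategory B]

/-- If `δ` restricts to `δ'` along `e`, then the comparison functor of `δ` and that of `δ'` agree
up to restriction along `e` and along the tensor functor `E`. The isomorphism is the associator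
of composition of functors. -/
def comparisonRestrictIso {F G : I ⥤ A} (e : J ⥤ I) (E : TensorFunctor A A')
    (P : TensorFunctor A' B)
    (δ : F ⋙ (E.comp P).toFunctor ⟶ G ⋙ (E.comp P).toFunctor)
    (δ' : ((e ⋙ F) ⋙ E.toFunctor) ⋙ P.toFunctor ⟶ ((e ⋙ G) ⋙ E.toFunctor) ⋙ P.toFunctor)
    (h : Functor.whiskerLeft e δ = δ') :
    tensorCoinserterComparison (E.comp P) δ C ⋙ CoinsertingTensorFunctor.reindex e F G ≅
      tensorCoinserterComparison P δ' C ⋙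
        CoinsertingTensorFunctor.restrict E (e ⋙ F) (e ⋙ G) :=
  NatIso.ofComponents
    (fun K ↦
      CoinsertingTensorFunctor.isoMk
        (Functor.associator E.toFunctor P.toFunctor K.toFunctor)
        (inferInstanceAs (NatTrans.IsMonoidal
          (Functor.associator E.toFunctor P.toFunctor K.toFunctor).hom))
        (by
          subst h
          ext j
          exact (Category.comp_id _).trans (Category.id_comp _).symm))
    (fun θ ↦ by
      ext X
      exact (Category.comp_id _).trans (Category.id_comp _).symm)

end

end Invariance

end TensorCat

theorem mainTheorem5
    {A : Type u₁} [Category.{v₁} A] [MonoidalCategory A] [SymmetricCategory A]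
    [EssentiallySmall.{w} A]
    {I : Type u₂} [Category.{v₂} I] [EssentiallySmall.{w} I] (F G : I ⥤ A) :
    ∃ (B : Type w) (_ : Category.{w} B) (_ : MonoidalCategory B) (_ : SymmetricCategory B)
      (P : TensorCat.TensorFunctor A B) (δ : F ⋙ P.toFunctor ⟶ G ⋙ P.toFunctor),
      ∀ (C : Type u₃) [Category.{v₃} C] [MonoidalCategory C] [SymmetricCategory C]
        [EssentiallySmall.{w} C],
        (TensorCat.tensorCoinserterComparison P δ C).IsEquivalence := by
  -- Small models `E : A → A'` of the tensor category and `r : J ⥤ I` of the index category.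
  let E : TensorCat.TensorFunctor A (Monoidal.Transported (equivSmallModel.{w} A)) :=
    { toFunctor := (Monoidal.equivalenceTransported (equivSmallModel.{w} A)).functor }
  let r : SmallModel.{w} I ⥤ I := (equivSmallModel.{w} I).inverse
  let F' := (r ⋙ F) ⋙ E.toFunctor
  let G' := (r ⋙ G) ⋙ E.toFunctor
  let P := E.comp (TensorCat.TensorCoinserter.inclTensor F' G')
  -- The universal transformation is indexed by the small model of `I`; it extends uniquely to `I`.
  let δ : F ⋙ P.toFunctor ⟶ G ⋙ P.toFunctor :=
    ((Functor.whiskeringLeft _ _ _).obj r).preimage (TensorCat.TensorCoinserter.nat F' G')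
  refine ⟨TensorCat.TensorCoinserter F' G', inferInstance, inferInstance, inferInstance, P, δ, ?_⟩
  intro C _ _ _ _
  have : (Monoidal.equivalenceTransported (equivSmallModel.{w} A)).IsMonoidal :=
    inferInstanceAs (Monoidal.equivalenceTransported (equivSmallModel.{w} A)).symm.symm.IsMonoidal
  have : (TensorCat.CoinsertingTensorFunctor.restrict (C := C) E (r ⋙ F) (r ⋙ G)).IsEquivalence :=
    TensorCat.CoinsertingTensorFunctor.isEquivalence_restrict
      (Monoidal.equivalenceTransported (equivSmallModel.{w} A)) (r ⋙ F) (r ⋙ G)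
  let i :=
    TensorCat.comparisonRestrictIso (C := C) r E (TensorCat.TensorCoinserter.inclTensor F' G') δ
      (TensorCat.TensorCoinserter.nat F' G') (((Functor.whiskeringLeft _ _ _).obj r).map_preimage
        (X := F ⋙ P.toFunctor) (Y := G ⋙ P.toFunctor) (TensorCat.TensorCoinserter.nat F' G'))
  have := Functor.isEquivalence_of_iso i.symm
  exact Functor.isEquivalence_of_comp_right _ (TensorCat.CoinsertingTensorFunctor.reindex r F G)
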